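/- Let $\ell,n\ge 1$ be integers and let $\mathbb{H}=\{x\in\mathbb{R}^n : \sum_{s} x_s=0\}$. For a real $\ell\times(n-1)$ matrix $a=(a_{i,j})$, put $A_{i,s,t}=\sum_{s\le j<t}a_{i,j}$ for $1\le s\le t\le n$ and $A_{i,t,s}=-A_{i,s,t}$. The $i$-th copy of the braid arrangement is the arrangement of the hyperplanes $\{x\in\mathbb{H} : x_s-x_t=A_{i,s,t}\}$ with $1\le s<t\le n$. The matrix $a$ is generic if for all $m\ge1$, all $i_1,\dots,i_m\in[\ell]$ and all distinct $r_1,\dots,r_m\in[n]$, with $r_0=r_m$, the equality $\sum_{j=1}^m A_{i_j,r_{j-1},r_j}=0$ implies $i_1=\dots=i_m$. For a generic matrix $a$, the $(\ell,n)$-braid arrangement is the union of the $\ell$ copies, for $i\in[\ell]$. A flat of an arrangement in $\mathbb{H}$ is a non-empty intersection of some (possibly none) of its hyperplanes. A region is a connected component of the complement of the union of its hyperplanes, a face is a non-empty intersection of the closure of a region with some (possibly none) of the hyperplanes, and a vertex is a point $v$ such that $\{v\}$ is a face. Theorem. Let $a$ be generic and let $k_1,\dots,k_\ell$ be integers with $0\le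 k_i\le n-1$ and $\sum_{i=1}^{\ell} k_i=n-1$. The number of vertices $v$ of the $(\ell,n)$-braid arrangement such that, for every $i\in[\ell]$, the smallest flat of the $i$-th copy of the braid arrangement containing $v$ has dimension $n-k_i-1$ equals $$n^{\ell-1}\binom{n-1}{k_1,\dots,k_\ell}\prod_{i=1}^{\ell}(n-k_i)^{k_i-1}.$$ -/

import Mathlib

namespace MultiBraid

/-! Affine hyperplane arrangements (given as sets of affine subspaces). -/

section Arrangement

variable {E : Type*} [AddCommGroup E] [Module ℝ E]

/-- A flat of `𝒜`: a non-empty affine subspace that is the intersection of some members of `𝒜`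
(the empty intersection is the whole space). -/
def IsFlat (𝒜 : Set (AffineSubspace ℝ E)) (F : AffineSubspace ℝ E) : Prop :=
  (F : Set E).Nonempty ∧ ∃ ℬ ⊆ 𝒜, F = sInf ℬ

/-- `F` is the smallest flat of `𝒜` containing the point `v`. -/
def IsSmallestFlatContaining (𝒜 : Set (AffineSubspace ℝ E)) (v : E)
    (F : AffineSubspace ℝ E) : Prop :=
  IsLeast {G : AffineSubspace ℝ E | IsFlat 𝒜 G ∧ v ∈ G} F

/-- The complement of the union of the hyperplanes of `𝒜`. -/
def complement (𝒜 : Set (AffineSubspace ℝ E)) : Set E :=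
  (⋃ H ∈ 𝒜, (H : Set E))ᶜ

variable [TopologicalSpace E]

/-- A region of `𝒜`: a connected component of the complement of the hyperplanes. -/
def IsRegion (𝒜 : Set (AffineSubspace ℝ E)) (R : Set E) : Prop :=
  ∃ x ∈ complement 𝒜, R = connectedComponentIn (complement 𝒜) x

/-- A face of `𝒜`: a non-empty intersection of the closure of a region with
some (possibly no) hyperplanes of `𝒜`. -/
def IsFace (𝒜 : Set (AffineSubspace ℝ E)) (F : Set E) : Prop :=
  F.Nonempty ∧ ∃ R, IsRegion 𝒜 R ∧ ∃ ℬ ⊆ 𝒜, F = closure R ∩ ⋂ H ∈ ℬ, (H : Set E)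

/-- A vertex of `𝒜`: a point that is a (zero-dimensional) face. -/
def IsVertex (𝒜 : Set (AffineSubspace ℝ E)) (v : E) : Prop :=
  IsFace 𝒜 {v}

end Arrangement

/-! Multiple braid arrangements. -/

/-- The hyperplane `∑ s, x s = 0` of `ℝⁿ`. Only its linear structure and its topology are used. -/
def sumZero (n : ℕ) : Submodule ℝ (Fin n → ℝ) where
  carrier := {x | ∑ s, x s = 0}
  zero_mem' := by simp
  add_mem' := by
    intro x y hx hy
    simp only [Set.mem_ofPred_eq] at hx hy
    simp [Finset.sum_add_distrib, hx, hy]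
  smul_mem' := by
    intro c x hx
    simp only [Set.mem_ofPred_eq] at hx
    simp [← Finset.mul_sum, hx]

/-- `A_{i,s,t} = ∑_{s ≤ j < t} a_{i,j}` for `s ≤ t`, extended by `A_{i,t,s} = -A_{i,s,t}`.
(With indices starting at `0`, rows of `a` are indexed by copies.) -/
def shift {ℓ n : ℕ} (a : Matrix (Fin ℓ) (Fin (n - 1)) ℝ) (i : Fin ℓ) (s t : Fin n) : ℝ :=
  (∑ j ∈ Finset.univ.filter
      (fun j : Fin (n - 1) => (s : ℕ) ≤ (j : ℕ) ∧ (j : ℕ) < (t : ℕ)), a i j) -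
    ∑ j ∈ Finset.univ.filter
      (fun j : Fin (n - 1) => (t : ℕ) ≤ (j : ℕ) ∧ (j : ℕ) < (s : ℕ)), a i j

/-- The affine subspace `{x | x s - x t = c}` of the hyperplane `∑ s, x s = 0`. -/
def rootHyperplane {n : ℕ} (s t : Fin n) (c : ℝ) : AffineSubspace ℝ (sumZero n) where
  carrier := {x | (x : Fin n → ℝ) s - (x : Fin n → ℝ) t = c}
  smul_vsub_vadd_mem' := by
    intro r x y z hx hy hz
    simp only [Set.mem_ofPred_eq] at hx hy hz
    simp only [vsub_eq_sub, vadd_eq_add, Set.mem_ofPred_eq, Submodule.coe_add, Submodule.coe_smul,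
      Submodule.coe_sub, Pi.add_apply, Pi.smul_apply, Pi.sub_apply, smul_eq_mul]
    linear_combination r * hx - r * hy + hz

/-- The `i`-th translated copy of the braid arrangement. -/
def braidCopy {ℓ n : ℕ} (a : Matrix (Fin ℓ) (Fin (n - 1)) ℝ) (i : Fin ℓ) :
    Set (AffineSubspace ℝ (sumZero n)) :=
  {H | ∃ s t : Fin n, s < t ∧ H = rootHyperplane s t (shift a i s t)}

/-- The `a`-braid arrangement, the union of the `ℓ` translated copies. -/
def multiBraid {ℓ n : ℕ} (a : Matrix (Fin ℓ) (Fin (n - 1)) ℝ) :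
    Set (AffineSubspace ℝ (sumZero n)) :=
  ⋃ i, braidCopy a i

/-- Genericity of `a`: for colors `c_0, …, c_k` and distinct `r_0, …, r_k`, if
`∑ j, A_{c_j, r_{j-1}, r_j} = 0` (index `j - 1` taken cyclically, as subtraction in `Fin (k + 1)`),
then all the colors are equal. -/
def IsGeneric {ℓ n : ℕ} (a : Matrix (Fin ℓ) (Fin (n - 1)) ℝ) : Prop :=
  ∀ (k : ℕ) (c : Fin (k + 1) → Fin ℓ) (r : Fin (k + 1) → Fin n), Function.Injective r →
    ∑ j, shift a (c j) (r (j - 1)) (r j) = 0 → ∀ j j', c j = c j'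

end MultiBraid

/-! A point `v` determines one partition of `[n]` for each copy: `s` and `t` lie in the same block
when the `i`-th copy has a hyperplane for this pair through `v`. The smallest flat of that copy
containing `v` has dimension one less than the number of blocks, and `v` is a vertex exactly when
the partitions have join `⊤`; in that case they determine `v`. Genericity makes every tuple of
partitions with join `⊤` and ranks `k i` adding up to `n - 1` occur: such a tuple is a hypertree, so
its equations can be solved along a tree (`IsGeneric.exists_flatPartition_eq`), and any further
relation at the solution would close a cycle with vanishing sum, which genericity allows only in a
single color (`IsGeneric.flatPartition_le`).

It remains to count the tuples (`card_hypertrees`). After a root is fixed, each one comes from a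
unique tree in which every other vertex carries a color different from that of its parent: color `i`
merges its vertices with their parents. There are multinomially many colorings with class sizes `k
i`, and for each of them the trees are counted by a determinant, as in the matrix-tree theorem
(`card_parentMaps`, `det_multipartite`). -/

namespace MultiBraid

/-! ### Colorings and the multipartite determinant. -/

section Counting

/-- The number of colorings with prescribed sizes of the color classes is a multinomial
coefficient. -/
theorem card_colorings {X ι : Type*} [Fintype X] [DecidableEq X] [Fintype ι] [DecidableEq ι]
    (k : ι → ℕ) (hk : ∑ i, k i = Fintype.card X) :
    Fintype.card {c : X → ι // ∀ i, Fintype.card {x // c x = i} = k i} =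
      Nat.multinomial Finset.univ k := by
  -- Expanding the power factor by factor lists all colorings by their class sizes; the multinomial
  -- theorem gives the same coefficients.
  have h1 : (∑ i, (MvPolynomial.X i : MvPolynomial ι ℕ)) ^ Fintype.card X =
      ∑ c : X → ι, ∏ i, MvPolynomial.X i ^ Fintype.card {x // c x = i} := by
    rw [← Finset.card_univ, ← Finset.prod_const, Finset.prod_univ_sum]
    refine Finset.sum_congr (by simp) fun c _ => ?_
    rw [← Finset.prod_fiberwise Finset.univ c]
    refine Finset.prod_congr rfl fun i _ => ?_
    rw [Finset.prod_congr rfl (g := fun _ => (MvPolynomial.X i : MvPolynomial ι ℕ)),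
      Finset.prod_const, Fintype.card_subtype]
    intro x hx
    rw [(Finset.mem_filter.1 hx).2]
  rw [Finset.sum_pow_eq_sum_piAntidiag] at h1
  have h2 := congrArg (MvPolynomial.coeff (Finsupp.equivFunOnFinite.symm k)) h1
  have key : ∀ k' : ι → ℕ, (∀ i ∈ Finset.univ, Finsupp.equivFunOnFinite.symm k i = k' i) ↔
      k' = k := by
    intro k'
    simp [funext_iff, eq_comm]
  have key2 : ∀ k' : ι → ℕ, MvPolynomial.coeff (Finsupp.equivFunOnFinite.symm k)
      (∏ i, (MvPolynomial.X i : MvPolynomial ι ℕ) ^ k' i) = if k' = k then 1 else 0 := by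
    intro k'
    rw [MvPolynomial.prod_X_pow, MvPolynomial.coeff_monomial]
    refine if_congr ?_ rfl rfl
    simp [Finsupp.ext_iff, funext_iff, Finsupp.indicator_apply]
  simp only [MvPolynomial.coeff_sum, key2, ← MvPolynomial.C_eq_coe_nat,
    MvPolynomial.coeff_C_mul, mul_ite, mul_one, mul_zero] at h2
  rw [Finset.sum_ite_eq' , if_pos (by simp [hk])] at h2
  rw [Fintype.card_subtype, Finset.card_filter]
  simp only [funext_iff] at h2
  simpa using h2.symm

/-- The determinant counting the spanning trees of a complete multipartite graph with one
additional vertex, joined to all the others, as root. -/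
theorem det_multipartite {X ι : Type*} [Fintype X] [DecidableEq X] [Fintype ι] [DecidableEq ι]
    (c : X → ι) (k : ι → ℕ) (hk : ∀ i, Fintype.card {x // c x = i} = k i) (N : ℚ)
    (hN : N = Fintype.card X + 1) :
    (Matrix.of fun v w : X => (if v = w then N - k (c v) else 0) -
      (if c w ≠ c v then (1 : ℚ) else 0)).det =
      N⁻¹ * ∏ i, (N * (N - k i) ^ ((k i : ℤ) - 1)) := by
  have hle : ∀ i, k i ≤ Fintype.card X := fun i => hk i ▸ Fintype.card_subtype_le _
  have hpos : ∀ i, N - k i ≠ 0 := by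
    intro i
    have : (k i : ℚ) ≤ Fintype.card X := by exact_mod_cast hle i
    linarith
  have hN0 : N ≠ 0 := by
    rw [hN]; positivity
  have hsum : ∑ i, (k i : ℚ) = Fintype.card X := by
    rw [← Nat.cast_sum, ← Finset.sum_congr rfl fun i _ => hk i, ← Fintype.card_sigma]
    exact congrArg _ (Fintype.card_congr (Equiv.sigmaFiberEquiv c))
  let P : Matrix X ι ℚ := Matrix.of fun v i => if c v = i then 1 else 0
  let D : Matrix X X ℚ := Matrix.diagonal fun v => N - k (c v)
  let J : Matrix ι ι ℚ := Matrix.of fun _ _ => 1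
  have hD : D.det = ∏ i, (N - k i) ^ k i := by
    rw [Matrix.det_diagonal, Finset.prod_comp (fun i => N - (k i : ℚ)) c,
      Finset.prod_subset (Finset.subset_univ _)]
    · exact Finset.prod_congr rfl fun i _ => by rw [← Fintype.card_subtype, hk]
    · intro i _ hi
      rw [← Fintype.card_subtype, hk]
      have : k i = 0 := by
        rw [← hk, Fintype.card_eq_zero_iff]
        exact ⟨fun x => hi (Finset.mem_image.2 ⟨x.1, Finset.mem_univ _, x.2⟩)⟩
      rw [this, pow_zero]
  have hDu : IsUnit D.det := by
    rw [hD, isUnit_iff_ne_zero]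
    exact Finset.prod_ne_zero_iff.2 fun i _ => pow_ne_zero _ (hpos i)
  -- The off-diagonal part depends only on colors, so it factors through `ι` and the determinant
  -- reduces to one of size `ι`.
  have hM : (Matrix.of fun v w : X => (if v = w then N - k (c v) else 0) -
      (if c w ≠ c v then (1 : ℚ) else 0)) = D + P * ((1 - J) * P.transpose) := by
    ext v w
    have : (P * ((1 - J) * P.transpose) : Matrix X X ℚ) v w = (if c v = c w then 1 else 0) - 1 := by
      simp [P, J, Matrix.mul_apply, Matrix.sub_apply, Matrix.one_apply]
    rw [Matrix.add_apply, this]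
    by_cases h : c v = c w
    · simp [D, Matrix.diagonal_apply, h]
    · simp [D, Matrix.diagonal_apply, h, Ne.symm h]
      ring
  have hDinv : D⁻¹ = Matrix.diagonal fun v => (N - k (c v))⁻¹ := by
    refine Matrix.inv_eq_right_inv ?_
    rw [Matrix.diagonal_mul_diagonal, ← Matrix.diagonal_one]
    congr 1
    ext v
    exact mul_inv_cancel₀ (hpos _)
  have hK : P.transpose * D⁻¹ * P = Matrix.diagonal fun i => k i * (N - k i)⁻¹ := by
    ext i j
    rw [hDinv, Matrix.mul_apply]
    simp only [Matrix.mul_diagonal, P, Matrix.transpose_apply, Matrix.of_apply,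
      Matrix.diagonal_apply]
    by_cases h : i = j
    · subst h
      have : (k i : ℚ) = ∑ v, if c v = i then 1 else 0 := by
        rw [← hk, Fintype.card_subtype, Finset.card_filter, Nat.cast_sum]
        simp
      rw [if_pos rfl, this, Finset.sum_mul, ← this]
      refine Finset.sum_congr rfl fun v _ => ?_
      by_cases hv : c v = i
      · simp [hv]
      · simp [hv]
    · rw [if_neg h]
      refine Finset.sum_eq_zero fun v _ => ?_
      by_cases hv : c v = i
      · simp [hv, h]
      · simp [hv]
  let E : Matrix ι ι ℚ := Matrix.diagonal fun i => N * (N - k i)⁻¹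
  have hE : E.det = ∏ i, (N * (N - k i)⁻¹) := Matrix.det_diagonal
  have hEu : IsUnit E.det := by
    rw [hE, isUnit_iff_ne_zero]
    exact Finset.prod_ne_zero_iff.2 fun i _ => mul_ne_zero hN0 (inv_ne_zero (hpos i))
  have hEinv : E⁻¹ = Matrix.diagonal fun i => N⁻¹ * (N - k i) := by
    refine Matrix.inv_eq_right_inv ?_
    rw [Matrix.diagonal_mul_diagonal, ← Matrix.diagonal_one]
    congr 1
    ext i
    have := hpos i
    field_simp
  -- The reduced matrix is a diagonal matrix plus one of rank one, so the determinant lemma applies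
  -- a second time.
  have hE2 : 1 + (1 - J) * P.transpose * D⁻¹ * P =
      E + Matrix.replicateCol Unit (fun _ => (-1 : ℚ)) *
        Matrix.replicateRow Unit (fun i => k i * (N - k i)⁻¹) := by
    rw [Matrix.mul_assoc (1 - J), Matrix.mul_assoc (1 - J), hK]
    ext i j
    have hj := hpos j
    have hi := hpos i
    simp only [Matrix.add_apply, Matrix.mul_diagonal]
    simp only [Matrix.sub_apply, E, J, Matrix.of_apply,
      Matrix.one_apply, Matrix.diagonal_apply, Matrix.mul_apply, Matrix.replicateCol_apply,
      Matrix.replicateRow_apply, Finset.univ_unique, Finset.sum_singleton]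
    by_cases h : i = j
    · subst h
      simp only [if_true]
      field_simp
      ring
    · simp only [if_neg h]
      ring
  rw [hM, Matrix.det_add_mul _ _ hDu, hE2, Matrix.det_add_replicateCol_mul_replicateRow hEu, hD,
    hE, hEinv]
  -- The sum collapses to `1 - (∑ i, k i) / N`, and `∑ i, k i = N - 1`.
  have hlast : 1 + ∑ i, (k i : ℚ) * (N - k i)⁻¹ * (N⁻¹ * (N - k i)) * -1 = N⁻¹ := by
    have : ∀ i, (k i : ℚ) * (N - k i)⁻¹ * (N⁻¹ * (N - k i)) * -1 = -N⁻¹ * k i := by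
      intro i
      have := hpos i
      field_simp
    rw [Finset.sum_congr rfl fun i _ => this i, ← Finset.mul_sum, hsum]
    have : (Fintype.card X : ℚ) = N - 1 := by rw [hN]; ring
    rw [this]
    field_simp
    ring
  rw [Matrix.det_unique, Matrix.add_apply, Matrix.one_apply_eq, Matrix.mul_apply]
  simp only [Matrix.mul_diagonal, Matrix.replicateRow_apply, Matrix.replicateCol_apply]
  rw [hlast, ← mul_assoc, ← Finset.prod_mul_distrib, mul_comm]
  congr 1
  refine Finset.prod_congr rfl fun i _ => ?_
  rw [zpow_sub₀ (hpos i), zpow_natCast, zpow_one]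
  ring

end Counting
-- Rooted trees with properly colored non-root vertices.
section Trees

variable {V ι : Type*} {r : V}

/-- `f` sends every vertex other than `r` to its parent in a tree with root `r`: following `f`
decreases some height function. -/
def IsParentMap (f : {v : V // v ≠ r} → V) : Prop :=
  ∃ d : V → ℕ, ∀ v : {v : V // v ≠ r}, d (f v) < d v

/-- No vertex has the color of its parent. -/
def IsProper (c : {v : V // v ≠ r} → ι) (f : {v : V // v ≠ r} → V) : Prop :=
  ∀ (v : {v : V // v ≠ r}) (h : f v ≠ r), c ⟨f v, h⟩ ≠ c v

/-- The identity minus the matrix of the partial map `f`. -/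
def parentMatrix (K : Type*) [Ring K] [DecidableEq V] (f : {v : V // v ≠ r} → V) :
    Matrix {v : V // v ≠ r} {v : V // v ≠ r} K :=
  Matrix.of fun v w => (if v = w then 1 else 0) - (if f v = w then 1 else 0)

/-- Ordering the vertices by height makes the matrix block triangular. A parent never has the height
of its child, so the diagonal blocks are identities. -/
theorem det_parentMatrix_of_isParentMap (K : Type*) [CommRing K] [Fintype V] [DecidableEq V]
    {f : {v : V // v ≠ r} → V} (hf : IsParentMap f) : (parentMatrix K f).det = 1 := by
  obtain ⟨d, hd⟩ := hf
  have hne : ∀ v w : {v : V // v ≠ r}, d v ≤ d w → f v ≠ w := by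
    intro v w hvw h
    have := hd v
    rw [h] at this
    omega
  have hb : (parentMatrix K f).BlockTriangular fun v => OrderDual.toDual (d v) := by
    intro v w hvw
    have h1 : d v < d w := hvw
    have h2 : v ≠ w := by rintro rfl; exact lt_irrefl _ h1
    simp [parentMatrix, h2, hne v w h1.le]
  rw [hb.det]
  refine Finset.prod_eq_one fun a _ => ?_
  have hone : (parentMatrix K f).toSquareBlock (fun v => OrderDual.toDual (d v)) a = 1 := by
    ext v w
    have h1 : d v.1 ≤ d w.1 := (OrderDual.toDual.injective (v.2.trans w.2.symm)).le
    simp [parentMatrix, Matrix.toSquareBlock_def, hne v.1 w.1 h1, Matrix.one_apply,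
      Subtype.ext_iff]
  rw [hone, Matrix.det_one]

/-- The indicator of the vertices that never reach the root is a nonzero kernel vector, because a
vertex reaches the root if and only if its image does. -/
theorem det_parentMatrix_of_not_isParentMap (K : Type*) [CommRing K] [IsDomain K] [Fintype V]
    [DecidableEq V] {f : {v : V // v ≠ r} → V} (hf : ¬ IsParentMap f) :
    (parentMatrix K f).det = 0 := by
  classical
  let g : V → V := fun v => if h : v ≠ r then f ⟨v, h⟩ else r
  have hg : ∀ v : {v : V // v ≠ r}, g v = f v := fun v => dif_pos v.2
  have hgr : g r = r := dif_neg (by simp)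
  let good : V → Prop := fun v => ∃ m, g^[m] v = r
  have hstep : ∀ v, good (g v) ↔ good v := by
    intro v
    constructor
    · rintro ⟨m, hm⟩
      exact ⟨m + 1, hm⟩
    · rintro ⟨m, hm⟩
      refine ⟨m, ?_⟩
      rw [← Function.iterate_succ_apply, Function.iterate_succ_apply', hm, hgr]
  have hbad : ∃ v, ¬ good v := by
    by_contra! hall
    refine hf ⟨fun v => Nat.find (hall v), fun v => ?_⟩
    have hpos : Nat.find (hall v) ≠ 0 := by
      intro h0
      have := Nat.find_spec (hall v)
      rw [h0] at this
      exact v.2 this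
    obtain ⟨m, hm⟩ := Nat.exists_eq_succ_of_ne_zero hpos
    have h1 := Nat.find_spec (hall v)
    rw [hm, Function.iterate_succ_apply, hg] at h1
    have := Nat.find_min' (hall (f v)) h1
    change Nat.find (hall (f v)) < Nat.find (hall v)
    omega
  obtain ⟨v₀, hv₀⟩ := hbad
  rw [← Matrix.exists_mulVec_eq_zero_iff]
  have hr : good r := ⟨0, rfl⟩
  refine ⟨fun v => if good v then 0 else 1, fun h => ?_, ?_⟩
  · have h1 := congrFun h ⟨v₀, fun h => hv₀ (h ▸ hr)⟩
    simp [hv₀] at h1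
  · ext v
    simp only [Matrix.mulVec, dotProduct, parentMatrix, Matrix.of_apply, sub_mul,
      Finset.sum_sub_distrib, ite_mul, one_mul, zero_mul, Finset.sum_ite_eq, Finset.mem_univ,
      if_true, Pi.zero_apply]
    have h1 : good (f v) ↔ good v := by rw [← hg, hstep]
    by_cases hfv : f v = r
    · have h2 : good v := h1.1 (hfv ▸ hr)
      rw [if_pos h2, Finset.sum_eq_zero, sub_zero]
      intro w _
      rw [if_neg]
      rw [hfv]
      exact fun h => w.2 h.symm
    · rw [Finset.sum_eq_single ⟨f v, hfv⟩]
      · simp [h1]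
      · intro w _ hw
        rw [if_neg fun h => hw (Subtype.ext h.symm)]
      · simp

-- A matrix-tree argument: row `v` of the multipartite matrix is the sum of `e_v - e_y` over the
-- allowed parents `y`, where `e_r = 0`. Multilinearity expands the determinant over all proper maps
-- `f`, and each term is 1 or 0 according to whether `f` is a tree.
open Classical in
theorem card_parentMaps [Fintype V] [DecidableEq V] [Fintype ι] [DecidableEq ι]
    (c : {v : V // v ≠ r} → ι) (k : ι → ℕ)
    (hk : ∀ i, Fintype.card {v // c v = i} = k i) :
    (Fintype.card {f : {v : V // v ≠ r} → V // IsProper c f ∧ IsParentMap f} : ℚ) =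
      (Fintype.card V : ℚ)⁻¹ *
        ∏ i, ((Fintype.card V : ℚ) * ((Fintype.card V : ℚ) - k i) ^ ((k i : ℤ) - 1)) := by
  have hcardX : (Fintype.card V : ℚ) = Fintype.card {v : V // v ≠ r} + 1 := by
    have h1 : 1 ≤ Fintype.card V := Fintype.card_pos_iff.2 ⟨r⟩
    have h2 : Fintype.card {v : V // v ≠ r} = Fintype.card V - 1 := by
      simp [Fintype.card_subtype_compl]
    rw [h2]
    push_cast [h1]
    ring
  rw [← det_multipartite c k hk _ hcardX]
  let A : {v : V // v ≠ r} → Finset V := fun v =>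
    Finset.univ.filter fun y => ∀ h : y ≠ r, c ⟨y, h⟩ ≠ c v
  let row : {v : V // v ≠ r} → V → ({v : V // v ≠ r} → ℚ) := fun v y w =>
    (if v = w then 1 else 0) - (if y = w then 1 else 0)
  have hAcard : ∀ v, ((A v).card : ℚ) = Fintype.card V - k (c v) := by
    intro v
    -- The forbidden parents of `v` are the vertices of its own color, `v` included.
    have h1 : (A v)ᶜ = (Finset.univ.filter fun w => c w = c v).map ⟨Subtype.val,
        Subtype.val_injective⟩ := by
      ext y
      simp [A]
    have h2 := Finset.card_add_card_compl (A v)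
    have h3 : (Finset.univ.filter fun w => c w = c v).card = k (c v) := by
      rw [← hk, Fintype.card_subtype]
    rw [h1, Finset.card_map, h3] at h2
    rw [← h2]
    push_cast
    ring
  have hrow : (Matrix.of fun v w => (if v = w then (Fintype.card V : ℚ) - k (c v) else 0) -
      (if c w ≠ c v then (1 : ℚ) else 0)) = fun v => ∑ y ∈ A v, row v y := by
    ext v w
    simp only [Matrix.of_apply, Finset.sum_apply, row, Finset.sum_sub_distrib]
    congr 1
    · rw [Finset.sum_const, nsmul_eq_mul, hAcard]
      simp
    · rw [Finset.sum_ite_eq' ]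
      refine if_congr ?_ rfl rfl
      simp [A, w.2]
  rw [hrow]
  have := (Matrix.detRowAlternating (R := ℚ)
    (n := {v : V // v ≠ r})).toMultilinearMap.map_sum_finset row A
  refine Eq.trans ?_ this.symm
  have hdet : ∀ f : {v : V // v ≠ r} → V,
      (Matrix.detRowAlternating (R := ℚ) (n := {v : V // v ≠ r})).toMultilinearMap
        (fun v => row v (f v)) = if IsParentMap f then 1 else 0 := by
    intro f
    split_ifs with hf
    · exact det_parentMatrix_of_isParentMap ℚ hf
    · exact det_parentMatrix_of_not_isParentMap ℚ hf
  rw [Finset.sum_congr rfl fun f _ => hdet f, Finset.sum_boole, Fintype.card_subtype]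
  congr 2
  ext f
  simp [A, IsProper, Fintype.mem_piFinset]

/-- The map sending the vertices of color `i` to their parents and fixing the others. -/
def retraction [DecidableEq V] [DecidableEq ι] (c : {v : V // v ≠ r} → ι)
    (f : {v : V // v ≠ r} → V) (i : ι) (v : V) : V :=
  if h : v ≠ r then if c ⟨v, h⟩ = i then f ⟨v, h⟩ else v else v

section Retraction

variable [DecidableEq V] [DecidableEq ι] {c : {v : V // v ≠ r} → ι} {f : {v : V // v ≠ r} → V}
  {i : ι}

theorem retraction_of_eq {v : {v : V // v ≠ r}} (h : c v = i) :
    retraction c f i v = f v := by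
  simp [retraction, v.2, h]

theorem retraction_of_ne {v : V} (h : ∀ hv : v ≠ r, c ⟨v, hv⟩ ≠ i) :
    retraction c f i v = v := by
  unfold retraction
  split_ifs with h1 h2
  · exact absurd h2 (h h1)
  all_goals rfl

theorem retraction_parent (hp : IsProper c f) (v : {v : V // v ≠ r}) :
    retraction c f (c v) (f v) = f v :=
  retraction_of_ne (hp v)

theorem range_retraction (hp : IsProper c f) :
    Set.range (retraction c f i) = {v | ∀ hv : v ≠ r, c ⟨v, hv⟩ ≠ i} := by
  ext v
  constructor
  · rintro ⟨w, rfl⟩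
    by_cases h : ∃ hw : w ≠ r, c ⟨w, hw⟩ = i
    · obtain ⟨hw, rfl⟩ := h
      rw [retraction_of_eq (v := ⟨w, hw⟩) rfl]
      exact hp _
    · push Not at h
      rw [retraction_of_ne h]
      exact h
  · intro hv
    exact ⟨v, retraction_of_ne hv⟩

theorem card_compl_color_class [Fintype V] :
    Nat.card {v : V | ∀ hv : v ≠ r, c ⟨v, hv⟩ ≠ i} + Fintype.card {v // c v = i} =
      Fintype.card V := by
  classical
  have h1 : (Finset.univ.filter fun v : V => ∀ hv : v ≠ r, c ⟨v, hv⟩ ≠ i)ᶜ =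
      (Finset.univ.filter fun w => c w = i).map ⟨Subtype.val, Subtype.val_injective⟩ := by
    ext y
    simp
  have h2 := Finset.card_add_card_compl
    (Finset.univ.filter fun v : V => ∀ hv : v ≠ r, c ⟨v, hv⟩ ≠ i)
  rw [h1, Finset.card_map] at h2
  rw [← h2, Fintype.card_subtype, Nat.card_eq_fintype_card, Fintype.card_subtype]
  simp

/-- The blocks correspond to the image of the retraction, which by properness consists of the
vertices not of color `i`, including the root. -/
theorem card_quotient_ker_retraction [Fintype V] (hp : IsProper c f) :
    Nat.card (Quotient (Setoid.ker (retraction c f i))) + Fintype.card {v // c v = i} =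
      Fintype.card V := by
  rw [Nat.card_congr (Setoid.quotientKerEquivRange _), range_retraction hp,
    card_compl_color_class]

theorem iSup_ker_retraction (hp : IsProper c f) (hf : IsParentMap f) :
    ⨆ i, Setoid.ker (retraction c f i) = ⊤ := by
  obtain ⟨d, hd⟩ := hf
  set S := ⨆ i, Setoid.ker (retraction c f i) with hS
  have hstep : ∀ v : {v : V // v ≠ r}, S v (f v) := by
    intro v
    refine (le_iSup (fun i => Setoid.ker (retraction c f i)) (c v) :
      Setoid.ker (retraction c f (c v)) ≤ S) ?_
    rw [Setoid.ker_def, retraction_of_eq rfl, retraction_parent hp]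
  have hroot : ∀ m v, d v = m → S v r := by
    intro m
    induction m using Nat.strong_induction_on with
    | _ m ih =>
      intro v hv
      by_cases h : v = r
      · rw [h]
      · exact S.trans (hstep ⟨v, h⟩) (ih _ (hv ▸ hd ⟨v, h⟩) _ rfl)
  rw [eq_top_iff]
  intro v w _
  exact S.trans (hroot _ v rfl) (S.symm (hroot _ w rfl))

/-- Induction on the height of `v` in the first tree. The parent `f v` already has the same color in
both colorings (or is the root), so the second retraction of color `c v` fixes it. Being related to
`f v ≠ v`, the vertex `v` must be moved there, hence has color `c v` and parent `f v`. -/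
theorem eq_of_ker_retraction_eq {c' : {v : V // v ≠ r} → ι} {f' : {v : V // v ≠ r} → V}
    (hp : IsProper c f) (hf : IsParentMap f)
    (h : ∀ i, Setoid.ker (retraction c f i) = Setoid.ker (retraction c' f' i)) :
    c = c' ∧ f = f' := by
  obtain ⟨d, hd⟩ := hf
  have key : ∀ m, ∀ v : {v : V // v ≠ r}, d v = m → c v = c' v ∧ f v = f' v := by
    intro m
    induction m using Nat.strong_induction_on with
    | _ m ih =>
      intro v hv
      have h1 : Setoid.ker (retraction c f (c v)) v (f v) := by
        rw [Setoid.ker_def, retraction_of_eq rfl, retraction_parent hp]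
      rw [h, Setoid.ker_def] at h1
      have h2 : retraction c' f' (c v) (f v) = f v := by
        refine retraction_of_ne fun hr => ?_
        rw [← (ih _ (hv ▸ hd v) ⟨f v, hr⟩ rfl).1]
        exact hp v hr
      rw [h2] at h1
      have h3 : c' v = c v := by
        by_contra h4
        rw [retraction_of_ne fun _ => h4] at h1
        have := hd v
        rw [← h1] at this
        exact lt_irrefl _ this
      rw [retraction_of_eq h3] at h1
      exact ⟨h3.symm, h1.symm⟩
  exact ⟨funext fun v => (key _ v rfl).1, funext fun v => (key _ v rfl).2⟩

end Retraction

end Trees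
-- Tuples of partitions as colored trees.
section Hypertrees

variable {V ι : Type*}

/-- The graph joining the pairs of distinct elements related by one of the relations. -/
def relGraph (π : ι → Setoid V) : SimpleGraph V where
  Adj v w := v ≠ w ∧ ∃ i, π i v w
  symm := ⟨fun _ _ h => ⟨h.1.symm, h.2.imp fun i hi => (π i).symm hi⟩⟩
  loopless := ⟨fun _ h => h.1 rfl⟩

theorem relGraph_connected [Nonempty V] {π : ι → Setoid V} (h : ⨆ i, π i = ⊤) :
    (relGraph π).Connected := by
  have hle : ⨆ i, π i ≤ (relGraph π).reachableSetoid := by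
    refine iSup_le fun i v w hvw => ?_
    by_cases hne : v = w
    · exact hne ▸ SimpleGraph.Reachable.refl _
    · exact SimpleGraph.Adj.reachable (G := relGraph π) ⟨hne, i, hvw⟩
  rw [h] at hle
  exact ⟨fun v w => hle (trivial : (⊤ : Setoid V) v w)⟩

theorem exists_adj_dist_lt {G : SimpleGraph V} (hG : G.Connected) {v r : V} (h : v ≠ r) :
    ∃ w, G.Adj v w ∧ G.dist w r < G.dist v r := by
  obtain ⟨p, hp⟩ := hG.exists_walk_length_eq_dist v r
  cases p with
  | nil => exact absurd rfl h
  | cons hadj q =>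
    refine ⟨_, hadj, ?_⟩
    rw [SimpleGraph.Walk.length_cons] at hp
    have h1 := SimpleGraph.dist_le q
    omega

/-- Every tuple of partitions of total rank `card V - 1` and with join `⊤` comes from a properly
colored rooted tree. -/
theorem exists_ker_retraction_eq [Fintype V] [DecidableEq V] [Fintype ι] [DecidableEq ι] (r : V)
    {k : ι → ℕ} (hk : ∑ i, k i + 1 = Fintype.card V) {π : ι → Setoid V}
    (hπ : ∀ i, Nat.card (Quotient (π i)) + k i = Fintype.card V) (hsup : ⨆ i, π i = ⊤) :
    ∃ (c : {v : V // v ≠ r} → ι) (f : {v : V // v ≠ r} → V),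
      (∀ i, Fintype.card {v // c v = i} = k i) ∧ IsProper c f ∧ IsParentMap f ∧
      ∀ i, Setoid.ker (retraction c f i) = π i := by
  classical
  have : Nonempty V := ⟨r⟩
  have hconn := relGraph_connected hsup
  let d : V → ℕ := fun v => (relGraph π).dist v r
  -- Each non-root vertex is given the color of some edge leading closer to the root.
  have hex : ∀ v : {v : V // v ≠ r}, ∃ i w, π i v w ∧ d w < d v := by
    rintro ⟨v, hv⟩
    obtain ⟨w, ⟨-, i, hi⟩, hw⟩ := exists_adj_dist_lt hconn hv
    exact ⟨i, w, hi, hw⟩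
  choose c w hcw hdw using hex
  have hmin : ∀ i (q : Quotient (π i)), ∃ v, Quotient.mk (π i) v = q ∧
      ∀ u, Quotient.mk (π i) u = q → d v ≤ d u := by
    intro i q
    obtain ⟨v, hv, hle⟩ := exists_minimalFor_of_wellFoundedLT
      (fun v => Quotient.mk (π i) v = q) d q.exists_rep
    exact ⟨v, hv, fun u hu => (le_total (d v) (d u)).elim id fun h => hle hu h⟩
  choose head hhead hheadmin using hmin
  -- A head of color `i` would have a vertex of its own block strictly closer to the root.
  have hcol : ∀ i q, ∀ h : head i q ≠ r, c ⟨head i q, h⟩ ≠ i := by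
    intro i q h hc
    have h1 := hcw ⟨head i q, h⟩
    have h2 := hdw ⟨head i q, h⟩
    rw [hc] at h1
    have h3 := hheadmin i q (w ⟨head i q, h⟩)
      ((Quotient.sound ((π i).symm h1)).trans (hhead i q))
    exact absurd h3 (not_le.2 h2)
  let φ : ∀ i, Quotient (π i) → {v : V | ∀ hv : v ≠ r, c ⟨v, hv⟩ ≠ i} :=
    fun i q => ⟨head i q, hcol i q⟩
  have hφ : ∀ i, Function.Injective (φ i) := by
    intro i q q' h
    have h1 : head i q = head i q' := congrArg Subtype.val h
    rw [← hhead i q, ← hhead i q', h1]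
  -- Heads of distinct blocks are distinct and avoid color `i`, which bounds the color class by `k
  -- i`. Both sides sum to `card V - 1`, so equality holds and every vertex not of color `i` is a
  -- head.
  have hle : ∀ i, Fintype.card {v // c v = i} ≤ k i := by
    intro i
    have h1 := Nat.card_le_card_of_injective _ (hφ i)
    have h2 := card_compl_color_class (c := c) (i := i)
    have h3 := hπ i
    omega
  have hsum : ∑ i, Fintype.card {v // c v = i} = ∑ i, k i := by
    rw [← Fintype.card_sigma, Fintype.card_congr (Equiv.sigmaFiberEquiv c)]
    have h2 : Fintype.card {v : V // v ≠ r} = Fintype.card V - 1 := by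
      simp [Fintype.card_subtype_compl]
    omega
  have hcard : ∀ i, Fintype.card {v // c v = i} = k i := fun i =>
    (Finset.sum_eq_sum_iff_of_le fun i _ => hle i).1 hsum i (Finset.mem_univ _)
  have hφs : ∀ i, Function.Bijective (φ i) := by
    intro i
    refine (Nat.bijective_iff_injective_and_card _).2 ⟨hφ i, ?_⟩
    have h2 := card_compl_color_class (c := c) (i := i)
    have h3 := hπ i
    rw [hcard] at h2
    omega
  let f : {v : V // v ≠ r} → V := fun v => head (c v) (Quotient.mk _ v)
  have hret : ∀ i v, retraction c f i v = head i (Quotient.mk _ v) := by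
    intro i v
    by_cases h : ∃ hv : v ≠ r, c ⟨v, hv⟩ = i
    · obtain ⟨hv, rfl⟩ := h
      rw [retraction_of_eq (v := ⟨v, hv⟩) rfl]
    · push Not at h
      rw [retraction_of_ne h]
      obtain ⟨q, hq⟩ := (hφs i).2 ⟨v, h⟩
      have h1 : head i q = v := congrArg Subtype.val hq
      have h2 := hhead i q
      rw [h1] at h2
      rw [h2, h1]
  refine ⟨c, f, hcard, fun v h => hcol _ _ h, ⟨d, fun v => ?_⟩, fun i => ?_⟩
  · exact (hheadmin (c v) _ (w v) (Quotient.sound ((π _).symm (hcw v)))).trans_lt (hdw v)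
  · ext v u
    rw [Setoid.ker_def, hret, hret]
    constructor
    · intro h
      refine Quotient.exact ?_
      rw [← hhead i (Quotient.mk _ v), h, hhead]
    · intro h
      rw [Quotient.sound h]

/-- The number of tuples of partitions of `V` with prescribed ranks adding up to `card V - 1` and
with join `⊤`. -/
theorem card_hypertrees [Fintype V] [Nonempty V] [Fintype ι] (k : ι → ℕ)
    (hk : ∑ i, k i + 1 = Fintype.card V) :
    (Nat.card {π : ι → Setoid V // (∀ i, Nat.card (Quotient (π i)) + k i = Fintype.card V) ∧
      ⨆ i, π i = ⊤} : ℚ) =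
    Nat.multinomial Finset.univ k * ((Fintype.card V : ℚ)⁻¹ *
      ∏ i, ((Fintype.card V : ℚ) * ((Fintype.card V : ℚ) - k i) ^ ((k i : ℤ) - 1))) := by
  classical
  obtain ⟨r⟩ := ‹Nonempty V›
  let Φ : (Σ c : {c : {v : V // v ≠ r} → ι // ∀ i, Fintype.card {v // c v = i} = k i},
      {f : {v : V // v ≠ r} → V // IsProper c.1 f ∧ IsParentMap f}) →
      {π : ι → Setoid V // (∀ i, Nat.card (Quotient (π i)) + k i = Fintype.card V) ∧
        ⨆ i, π i = ⊤} := fun x =>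
    ⟨fun i => Setoid.ker (retraction x.1.1 x.2.1 i),
      fun i => (x.1.2 i) ▸ card_quotient_ker_retraction x.2.2.1,
      iSup_ker_retraction x.2.2.1 x.2.2.2⟩
  have hΦ : Function.Bijective Φ := by
    constructor
    · rintro ⟨⟨c, hc⟩, f, hp, hf⟩ ⟨⟨c', hc'⟩, f', hp', hf'⟩ h
      obtain ⟨rfl, rfl⟩ := eq_of_ker_retraction_eq hp hf
        fun i => congrFun (congrArg Subtype.val h) i
      rfl
    · rintro ⟨π, hπ, hsup⟩
      obtain ⟨c, f, hc, hp, hf, h⟩ := exists_ker_retraction_eq r hk hπ hsup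
      exact ⟨⟨⟨c, hc⟩, f, hp, hf⟩, Subtype.ext (funext h)⟩
  rw [← Nat.card_congr (Equiv.ofBijective Φ hΦ), Nat.card_eq_fintype_card, Fintype.card_sigma,
    Nat.cast_sum, Finset.sum_congr rfl fun c _ => card_parentMaps c.1 k c.2, Finset.sum_const,
    nsmul_eq_mul, Finset.card_univ]
  have hX : ∑ i, k i = Fintype.card {v : V // v ≠ r} := by
    have h2 : Fintype.card {v : V // v ≠ r} = Fintype.card V - 1 := by
      simp [Fintype.card_subtype_compl]
    omega
  congr 2
  convert card_colorings k hX

end Hypertrees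
-- Flats and vertices in terms of partitions.
section Geometry

open Filter Topology

variable {ℓ n : ℕ} (a : Matrix (Fin ℓ) (Fin (n - 1)) ℝ)

/-- The translation vector of the `i`-th copy of the braid arrangement. -/
def height (i : Fin ℓ) (t : Fin n) : ℝ :=
  ∑ j ∈ Finset.univ.filter (fun j : Fin (n - 1) => (j : ℕ) < (t : ℕ)), a i j

/-- Since shifts are differences of a potential, each copy is a translated braid arrangement and
incidence with its hyperplanes is an equivalence relation on indices. -/
theorem shift_eq (i : Fin ℓ) (s t : Fin n) : shift a i s t = height a i t - height a i s := by
  simp only [shift, height, Finset.sum_filter, ← Finset.sum_sub_distrib]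
  refine Finset.sum_congr rfl fun j _ => ?_
  by_cases h1 : (j : ℕ) < s <;> by_cases h2 : (j : ℕ) < t <;>
    simp [h1, h2, not_le.2, not_lt.1]

/-- The partition of the indices given by the hyperplanes of the `i`-th copy through `v`. -/
def flatPartition (i : Fin ℓ) (v : sumZero n) : Setoid (Fin n) :=
  Setoid.ker fun s => (v : Fin n → ℝ) s + height a i s

variable {a}

theorem flatPartition_iff {i : Fin ℓ} {v : sumZero n} {s t : Fin n} :
    flatPartition a i v s t ↔ (v : Fin n → ℝ) s - (v : Fin n → ℝ) t = shift a i s t := by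
  rw [shift_eq, flatPartition, Setoid.ker_def]
  constructor <;> intro h <;> linarith

theorem mem_rootHyperplane {s t : Fin n} {c : ℝ} {v : sumZero n} :
    v ∈ rootHyperplane s t c ↔ (v : Fin n → ℝ) s - (v : Fin n → ℝ) t = c :=
  Iff.rfl

theorem mem_rootHyperplane_shift {i : Fin ℓ} {v : sumZero n} {s t : Fin n} :
    v ∈ rootHyperplane s t (shift a i s t) ↔ flatPartition a i v s t :=
  flatPartition_iff.symm

variable (a) in
/-- The intersection of the hyperplanes of the `i`-th copy containing `v`. -/
def minFlat (i : Fin ℓ) (v : sumZero n) : AffineSubspace ℝ (sumZero n) :=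
  sInf {H ∈ braidCopy a i | v ∈ H}

theorem mem_minFlat {i : Fin ℓ} {v x : sumZero n} :
    x ∈ minFlat a i v ↔ flatPartition a i v ≤ flatPartition a i x := by
  rw [minFlat, ← SetLike.mem_coe, AffineSubspace.coe_sInf, Set.mem_iInter₂]
  constructor
  · intro h s t hst
    rcases lt_trichotomy s t with hlt | rfl | hlt
    · exact mem_rootHyperplane_shift.1
        (h _ ⟨⟨s, t, hlt, rfl⟩, mem_rootHyperplane_shift.2 hst⟩)
    · exact Setoid.refl' _ _
    · exact Setoid.symm' _ (mem_rootHyperplane_shift.1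
        (h _ ⟨⟨t, s, hlt, rfl⟩, mem_rootHyperplane_shift.2 (Setoid.symm' _ hst)⟩))
  · rintro h _ ⟨⟨s, t, -, rfl⟩, hv⟩
    exact mem_rootHyperplane_shift.2 (h (mem_rootHyperplane_shift.1 hv))

theorem isSmallestFlatContaining_minFlat (i : Fin ℓ) (v : sumZero n) :
    IsSmallestFlatContaining (braidCopy a i) v (minFlat a i v) := by
  have hv : v ∈ minFlat a i v := mem_minFlat.2 le_rfl
  refine ⟨⟨⟨⟨v, hv⟩, _, Set.sep_subset _ _, rfl⟩, hv⟩, ?_⟩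
  rintro G ⟨⟨-, ℬ, hℬ, rfl⟩, hvG⟩
  refine sInf_le_sInf fun H hH => ⟨hℬ hH, ?_⟩
  exact (sInf_le hH : sInf ℬ ≤ H) hvG

theorem mem_direction_minFlat {i : Fin ℓ} {v y : sumZero n} :
    y ∈ (minFlat a i v).direction ↔
      ∀ s t, flatPartition a i v s t → (y : Fin n → ℝ) s = (y : Fin n → ℝ) t := by
  rw [← AffineSubspace.vadd_mem_iff_mem_direction y (mem_minFlat.2 le_rfl), mem_minFlat]
  refine forall₂_congr fun s t => imp_congr_right fun h => ?_
  rw [flatPartition, Setoid.ker_def] at h ⊢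
  simp only [vadd_eq_add, Submodule.coe_add, Pi.add_apply]
  constructor <;> intro h' <;> linarith

/-- The direction consists of the functions on blocks whose sum weighted by block sizes is zero, the
kernel of a nonzero functional. -/
theorem finrank_direction_minFlat (hn : 1 ≤ n) (i : Fin ℓ) (v : sumZero n) :
    Module.finrank ℝ (minFlat a i v).direction + 1 =
      Nat.card (Quotient (flatPartition a i v)) := by
  classical
  let Q := Quotient (flatPartition a i v)
  have : Fintype Q := Fintype.ofFinite _
  let φ : (Q → ℝ) →ₗ[ℝ] ℝ := ∑ s : Fin n, LinearMap.proj (Quotient.mk _ s)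
  have hφ : ∀ g, φ g = ∑ s : Fin n, g (Quotient.mk _ s) := fun g => by
    simp [φ]
  have hrange : LinearMap.range φ = ⊤ := by
    refine LinearMap.range_eq_top.2 (LinearMap.surjective_of_ne_zero fun h => ?_)
    have h1 := hφ 1
    have h2 : (n : ℝ) ≠ 0 := by positivity
    rw [h] at h1
    exact h2 (by simpa using h1.symm)
  have h1 := LinearMap.finrank_range_add_finrank_ker φ
  rw [hrange, finrank_top, Module.finrank_self, Module.finrank_fintype_fun_eq_card,
    ← Nat.card_eq_fintype_card] at h1
  let ψ : LinearMap.ker φ →ₗ[ℝ] sumZero n :=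
    { toFun := fun g => ⟨fun s => g.1 (Quotient.mk _ s), (hφ g.1).symm.trans g.2⟩
      map_add' := fun _ _ => rfl
      map_smul' := fun _ _ => rfl }
  have hψ : Function.Injective ψ := by
    intro g g' h
    ext q
    obtain ⟨s, rfl⟩ := q.exists_rep
    exact congrFun (congrArg Subtype.val h) s
  have hdir : (minFlat a i v).direction = LinearMap.range ψ := by
    ext y
    rw [mem_direction_minFlat]
    constructor
    · intro h
      refine ⟨⟨fun q => q.lift y.1 h, ?_⟩, rfl⟩
      rw [LinearMap.mem_ker, hφ]
      exact y.2
    · rintro ⟨g, rfl⟩ s t hst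
      exact congrArg g.1 (Quotient.sound hst)
  rw [hdir, LinearMap.finrank_range_of_inj hψ, add_comm]
  exact h1

theorem exists_smallestFlat_finrank_iff (hn : 1 ≤ n) {i : Fin ℓ} {v : sumZero n} {k : ℕ}
    (hk : k ≤ n - 1) :
    (∃ F, IsSmallestFlatContaining (braidCopy a i) v F ∧
      Module.finrank ℝ F.direction = n - k - 1) ↔
      Nat.card (Quotient (flatPartition a i v)) + k = Fintype.card (Fin n) := by
  have h1 := finrank_direction_minFlat (a := a) hn i v
  rw [Fintype.card_fin]
  constructor
  · rintro ⟨F, hF, h⟩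
    rw [hF.unique (isSmallestFlatContaining_minFlat i v)] at h
    omega
  · intro h
    exact ⟨_, isSmallestFlatContaining_minFlat i v, by omega⟩

/-- The projection of a vector to the hyperplane `∑ s, x s = 0` along the diagonal. -/
noncomputable def center (hn : 1 ≤ n) (x : Fin n → ℝ) : sumZero n :=
  ⟨fun s => x s - (∑ t, x t) / n, by
    have : (n : ℝ) ≠ 0 := by positivity
    change ∑ s, (x s - (∑ t, x t) / n) = 0
    rw [Finset.sum_sub_distrib, Finset.sum_const, Finset.card_univ, Fintype.card_fin, nsmul_eq_mul]
    field_simp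
    ring⟩

theorem center_sub (hn : 1 ≤ n) (x : Fin n → ℝ) (s t : Fin n) :
    (center hn x : Fin n → ℝ) s - (center hn x : Fin n → ℝ) t = x s - x t := by
  simp [center]

theorem eq_zero_of_forall_eq {y : sumZero n}
    (h : ∀ s t, (y : Fin n → ℝ) s = (y : Fin n → ℝ) t) : y = 0 := by
  ext s
  have h1 : ∑ t, (y : Fin n → ℝ) t = 0 := y.2
  rw [Finset.sum_congr rfl fun t _ => h t s, Finset.sum_const, Finset.card_univ,
    Fintype.card_fin, nsmul_eq_mul] at h1
  have : (n : ℝ) ≠ 0 := by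
    have := s.pos
    positivity
  simpa [this] using h1

/-- If the common hyperplanes of `v` and `w` connect all indices, then `v = w`. -/
theorem eq_of_flatPartition_le {v w : sumZero n} (hv : ⨆ i, flatPartition a i v = ⊤)
    (h : ∀ i, flatPartition a i v ≤ flatPartition a i w) : v = w := by
  rw [← sub_eq_zero]
  refine eq_zero_of_forall_eq fun s t => ?_
  have hle : ⨆ i, flatPartition a i v ≤ Setoid.ker ((v - w : sumZero n) : Fin n → ℝ) := by
    refine iSup_le fun i s t hst => ?_
    have h1 := flatPartition_iff.1 hst
    have h2 := flatPartition_iff.1 (h i hst)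
    rw [Setoid.ker_def]
    simp only [Submodule.coe_sub, Pi.sub_apply]
    linarith
  rw [hv] at hle
  exact hle (trivial : (⊤ : Setoid (Fin n)) s t)

theorem finite_multiBraid : (multiBraid a).Finite := by
  refine (Set.finite_range fun p : Fin ℓ × Fin n × Fin n =>
    rootHyperplane p.2.1 p.2.2 (shift a p.1 p.2.1 p.2.2)).subset ?_
  intro H hH
  obtain ⟨i, s, t, -, rfl⟩ := Set.mem_iUnion.1 hH
  exact ⟨(i, s, t), rfl⟩

theorem isClosed_rootHyperplane (s t : Fin n) (c : ℝ) :
    IsClosed (rootHyperplane s t c : Set (sumZero n)) := by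
  have h : (rootHyperplane s t c : Set (sumZero n)) =
      {x : sumZero n | (x : Fin n → ℝ) s - (x : Fin n → ℝ) t = c} := rfl
  rw [h]
  refine isClosed_eq ?_ continuous_const
  exact ((continuous_apply s).comp continuous_subtype_val).sub
    ((continuous_apply t).comp continuous_subtype_val)

theorem isClosed_of_mem_multiBraid {H : AffineSubspace ℝ (sumZero n)} (hH : H ∈ multiBraid a) :
    IsClosed (H : Set (sumZero n)) := by
  obtain ⟨i, s, t, -, rfl⟩ := Set.mem_iUnion.1 hH
  exact isClosed_rootHyperplane _ _ _

/-- A point in the closure of a region stays there when it is moved a little in a direction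
parallel to all hyperplanes through it. -/
theorem exists_add_smul_mem_closure {R : Set (sumZero n)} (hR : IsRegion (multiBraid a) R)
    {v y : sumZero n} (hv : v ∈ closure R)
    (hy : ∀ H ∈ multiBraid a, v ∈ H → ∀ (u : sumZero n) (τ : ℝ), u + τ • y ∈ H → u ∈ H) :
    ∃ ε : ℝ, 0 < ε ∧ v + ε • y ∈ closure R := by
  obtain ⟨x, hx, rfl⟩ := hR
  have hev : ∀ᶠ p : sumZero n × ℝ in 𝓝 (v, 0),
      ∀ H ∈ {H ∈ multiBraid a | v ∉ H}, p.1 + p.2 • y ∉ H := by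
    rw [eventually_all_finite (finite_multiBraid.subset (Set.sep_subset _ _))]
    rintro H ⟨hH, hvH⟩
    have hc : Continuous fun p : sumZero n × ℝ => p.1 + p.2 • y := by fun_prop
    refine hc.continuousAt.eventually_mem
      ((isClosed_of_mem_multiBraid hH).isOpen_compl.mem_nhds ?_)
    simpa using hvH
  obtain ⟨W, hW, T, hT, hWT⟩ := mem_nhds_prod_iff.1 hev
  obtain ⟨δ, hδ, hδT⟩ := Metric.mem_nhds_iff.1 hT
  refine ⟨δ / 2, by positivity, ?_⟩
  -- The short segment from `u` meets no hyperplane: those through `v` by the hypothesis on `y`, the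
  -- others because it stays near `v`.
  have hmaps : ∀ u ∈ W ∩ connectedComponentIn (complement (multiBraid a)) x,
      u + (δ / 2) • y ∈ connectedComponentIn (complement (multiBraid a)) x := by
    rintro u ⟨huW, huR⟩
    have hsub : (fun τ : ℝ => u + τ • y) '' Set.Icc 0 (δ / 2) ⊆ complement (multiBraid a) := by
      rintro _ ⟨τ, hτ, rfl⟩ hmem
      obtain ⟨H, hH, hmemH⟩ := Set.mem_iUnion₂.1 hmem
      by_cases hvH : v ∈ H
      · exact connectedComponentIn_subset _ _ huR
          (Set.mem_iUnion₂.2 ⟨H, hH, hy H hH hvH u τ hmemH⟩)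
      · refine hWT (Set.mk_mem_prod huW (hδT ?_)) H ⟨hH, hvH⟩ hmemH
        rw [Metric.mem_ball, dist_zero_right, Real.norm_eq_abs, abs_of_nonneg hτ.1]
        linarith [hτ.2]
    have hconn : IsPreconnected ((fun τ : ℝ => u + τ • y) '' Set.Icc 0 (δ / 2)) :=
      isPreconnected_Icc.image _ (by fun_prop)
    have h0 : u ∈ (fun τ : ℝ => u + τ • y) '' Set.Icc 0 (δ / 2) :=
      ⟨0, ⟨le_rfl, by positivity⟩, by simp⟩
    rw [connectedComponentIn_eq huR]
    exact hconn.subset_connectedComponentIn h0 hsub ⟨δ / 2, ⟨by positivity, le_rfl⟩, rfl⟩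
  have hcl : v ∈ closure (W ∩ connectedComponentIn (complement (multiBraid a)) x) :=
    mem_closure_iff_nhds.2 fun t ht => by
      obtain ⟨z, hz, hzR⟩ := mem_closure_iff_nhds.1 hv (t ∩ W) (inter_mem ht hW)
      exact ⟨z, hz.1, hz.2, hzR⟩
  exact map_mem_closure (f := fun u : sumZero n => u + (δ / 2) • y) (by fun_prop) hcl hmaps

/-- If the join is not `⊤`, the centered indicator of one of its blocks is a nonzero direction
parallel to every hyperplane through `v`. Moving a little along it stays in the same face, which is
then not a point. -/
theorem iSup_flatPartition_eq_top_of_isVertex (hn : 1 ≤ n) {v : sumZero n}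
    (hv : IsVertex (multiBraid a) v) : ⨆ i, flatPartition a i v = ⊤ := by
  classical
  set S := ⨆ i, flatPartition a i v with hS
  by_contra hne
  have hex : ∃ s t, ¬ S s t := by
    by_contra! hall
    exact hne (eq_top_iff.2 fun s t _ => hall s t)
  obtain ⟨s₀, t₀, hst⟩ := hex
  let y : sumZero n := center hn fun t => if S s₀ t then 1 else 0
  have hyS : ∀ s t, S s t → (y : Fin n → ℝ) s = (y : Fin n → ℝ) t := by
    intro s t h
    rw [← sub_eq_zero, center_sub]
    have : S s₀ s ↔ S s₀ t := ⟨fun h' => S.trans h' h, fun h' => S.trans h' (S.symm h)⟩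
    simp [this]
  have hy0 : y ≠ 0 := by
    intro h
    have h1 := center_sub hn (fun t => if S s₀ t then (1 : ℝ) else 0) s₀ t₀
    change (y : Fin n → ℝ) s₀ - (y : Fin n → ℝ) t₀ = _ at h1
    simp [h, hst] at h1
  have hypar : ∀ H ∈ multiBraid a, v ∈ H → ∀ (u : sumZero n) (τ : ℝ),
      u + τ • y ∈ H ↔ u ∈ H := by
    intro H hH hvH u τ
    obtain ⟨i, s, t, -, rfl⟩ := Set.mem_iUnion.1 hH
    have h1 := hyS s t ((le_iSup (fun i => flatPartition a i v) i : flatPartition a i v ≤ S)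
      (mem_rootHyperplane_shift.1 hvH))
    rw [mem_rootHyperplane, mem_rootHyperplane]
    simp only [Submodule.coe_add, Submodule.coe_smul, Pi.add_apply, Pi.smul_apply, smul_eq_mul, h1]
    constructor <;> intro h <;> linarith
  obtain ⟨-, R, hR, ℬ, hℬ, heq⟩ := hv
  have hmem : v ∈ closure R ∩ ⋂ H ∈ ℬ, (H : Set (sumZero n)) := heq ▸ Set.mem_singleton v
  obtain ⟨ε, hε, hcl⟩ := exists_add_smul_mem_closure hR hmem.1
    fun H hH hvH u τ => (hypar H hH hvH u τ).1
  have hmem' : v + ε • y ∈ closure R ∩ ⋂ H ∈ ℬ, (H : Set (sumZero n)) := by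
    refine ⟨hcl, Set.mem_iInter₂.2 fun H hH => ?_⟩
    have hvH : v ∈ H := Set.mem_iInter₂.1 hmem.2 H hH
    exact (hypar H (hℬ hH) hvH v ε).2 hvH
  rw [← heq, Set.mem_singleton_iff, add_eq_left, smul_eq_zero] at hmem'
  exact hmem'.elim hε.ne' hy0

theorem isVertex_of_iSup_flatPartition_eq_top (hn : 1 ≤ n) {v : sumZero n}
    (hv : ⨆ i, flatPartition a i v = ⊤) : IsVertex (multiBraid a) v := by
  -- The coordinates of this direction are distinct, so it is parallel to no hyperplane and a short
  -- open segment from `v` avoids them all. The region containing the segment has `v` in its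
  -- closure.
  let y : sumZero n := center hn fun s => (s : ℝ)
  have hev : ∀ᶠ τ : ℝ in 𝓝[>] 0, ∀ H ∈ multiBraid a, v + τ • y ∉ H := by
    rw [eventually_all_finite finite_multiBraid]
    intro H hH
    obtain ⟨i, s, t, hst, rfl⟩ := Set.mem_iUnion.1 hH
    have hst' : (s : ℝ) < t := by exact_mod_cast hst
    have hy := center_sub hn (fun s => (s : ℝ)) s t
    change (y : Fin n → ℝ) s - (y : Fin n → ℝ) t = _ at hy
    set τ₀ := ((v : Fin n → ℝ) s - (v : Fin n → ℝ) t - shift a i s t) / ((t : ℝ) - s) with hτ₀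
    have hne : ∀ᶠ τ : ℝ in 𝓝[>] 0, τ ≠ τ₀ := by
      by_cases h0 : (0 : ℝ) = τ₀
      · rw [← h0]
        filter_upwards [self_mem_nhdsWithin] with τ hτ using ne_of_gt hτ
      · exact eventually_ne_nhdsWithin h0
    filter_upwards [hne] with τ hτ hmem
    rw [mem_rootHyperplane] at hmem
    simp only [Submodule.coe_add, Submodule.coe_smul, Pi.add_apply, Pi.smul_apply,
      smul_eq_mul] at hmem
    refine hτ ?_
    rw [hτ₀, eq_div_iff (by linarith)]
    linear_combination -hmem + τ * hy
  obtain ⟨ε, hε, hsub⟩ := mem_nhdsGT_iff_exists_Ioo_subset.1 hev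
  have hε' : (0 : ℝ) < ε := hε
  let Z : Set (sumZero n) := (fun τ : ℝ => v + τ • y) '' Set.Ioo 0 ε
  have hZ : Z ⊆ complement (multiBraid a) := by
    rintro _ ⟨τ, hτ, rfl⟩ hmem
    obtain ⟨H, hH, hmemH⟩ := Set.mem_iUnion₂.1 hmem
    exact hsub hτ H hH hmemH
  have hconn : IsPreconnected Z := isPreconnected_Ioo.image _ (by fun_prop)
  have hx : v + (ε / 2) • y ∈ Z := ⟨ε / 2, ⟨by positivity, by linarith⟩, rfl⟩
  have hvZ : v ∈ closure Z := by
    have h0 : (0 : ℝ) ∈ closure (Set.Ioo 0 ε) := by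
      rw [closure_Ioo hε'.ne]
      exact ⟨le_rfl, hε'.le⟩
    have h1 := map_mem_closure (f := fun τ : ℝ => v + τ • y) (t := Z) (by fun_prop) h0
      fun τ hτ => ⟨τ, hτ, rfl⟩
    simpa using h1
  refine ⟨Set.singleton_nonempty v, _, ⟨_, hZ hx, rfl⟩, {H ∈ multiBraid a | v ∈ H},
    Set.sep_subset _ _, ?_⟩
  refine Set.Subset.antisymm ?_ ?_
  · rintro _ rfl
    exact ⟨closure_mono (hconn.subset_connectedComponentIn hx hZ) hvZ,
      Set.mem_iInter₂.2 fun H hH => hH.2⟩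
  · rintro w ⟨-, hw⟩
    refine (eq_of_flatPartition_le hv fun i => mem_minFlat.1 ?_).symm
    rw [minFlat, ← SetLike.mem_coe, AffineSubspace.coe_sInf, Set.mem_iInter₂]
    exact fun H hH => Set.mem_iInter₂.1 hw H ⟨Set.mem_iUnion.2 ⟨i, hH.1⟩, hH.2⟩

end Geometry
-- Genericity and the bijection with hypertrees.
section Bijection

theorem exists_sub_parent_eq {V K : Type*} [CommRing K] [Fintype V] {r : V}
    {f : {v : V // v ≠ r} → V} (hf : IsParentMap f) (b : {v : V // v ≠ r} → K) :
    ∃ x : V → K, ∀ v : {v : V // v ≠ r}, x v - x (f v) = b v := by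
  classical
  have hdet : IsUnit (parentMatrix K f).det := by
    rw [det_parentMatrix_of_isParentMap K hf]
    exact isUnit_one
  let y := (parentMatrix K f)⁻¹.mulVec b
  have hy : (parentMatrix K f).mulVec y = b := by
    rw [Matrix.mulVec_mulVec, Matrix.mul_nonsing_inv _ hdet, Matrix.one_mulVec]
  refine ⟨fun v => if h : v ≠ r then y ⟨v, h⟩ else 0, fun v => ?_⟩
  rw [← congrFun hy v]
  simp only [Matrix.mulVec, dotProduct, parentMatrix, Matrix.of_apply, sub_mul,
    Finset.sum_sub_distrib, ite_mul, one_mul, zero_mul, Finset.sum_ite_eq, Finset.mem_univ,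
    if_true]
  rw [dif_pos v.2]
  congr 1
  by_cases hfv : f v = r
  · rw [dif_neg (by simpa using hfv), Finset.sum_eq_zero]
    intro w _
    rw [if_neg]
    rw [hfv]
    exact fun h => w.2 h.symm
  · rw [dif_pos hfv, Finset.sum_eq_single ⟨f v, hfv⟩]
    · simp
    · intro w _ hw
      rw [if_neg fun h => hw (Subtype.ext h.symm)]
    · simp

variable {ℓ n : ℕ} {a : Matrix (Fin ℓ) (Fin (n - 1)) ℝ}

theorem flatPartition_center {hn : 1 ≤ n} {x : Fin n → ℝ} {i : Fin ℓ} {s t : Fin n} :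
    flatPartition a i (center hn x) s t ↔ x s + height a i s = x t + height a i t := by
  rw [flatPartition_iff, center_sub, shift_eq]
  constructor <;> intro h <;> linarith

/-- For a generic matrix, a point lying on hyperplanes that connect all indices lies on no
hyperplanes but those forced by these. -/
theorem IsGeneric.flatPartition_le (ha : IsGeneric a) {π : Fin ℓ → Setoid (Fin n)}
    (hsup : ⨆ i, π i = ⊤) {v : sumZero n} (hle : ∀ i, π i ≤ flatPartition a i v) (i : Fin ℓ) :
    flatPartition a i v ≤ π i := by
  intro s t hst
  have : Nonempty (Fin n) := ⟨s⟩
  obtain ⟨p, hp⟩ := (relGraph_connected hsup).exists_isPath s t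
  have hadj : ∀ j : Fin p.length, ∃ c, π c (p.getVert j) (p.getVert (j + 1)) :=
    fun j => (p.adj_getVert_succ j.2).2
  choose c hc using hadj
  -- The path from `s` to `t` is closed into a cycle by the extra relation of color `i`; index 0
  -- carries the closing step from `t` back to `s`.
  let c' : Fin (p.length + 1) → Fin ℓ := Fin.cons i c
  let r : Fin (p.length + 1) → Fin n := fun j => p.getVert j
  have hr : Function.Injective r := by
    intro j j' h
    exact Fin.ext (hp.getVert_injOn (Nat.lt_succ_iff.1 j.2) (Nat.lt_succ_iff.1 j'.2) h)
  have hflat : ∀ j, flatPartition a (c' j) v (r (j - 1)) (r j) := by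
    intro j
    induction j using Fin.cases with
    | zero =>
      have h1 : (0 : Fin (p.length + 1)) - 1 = Fin.last _ := by
        rw [sub_eq_iff_eq_add, Fin.last_add_one]
      have h2 : c' 0 = i := rfl
      rw [h1, h2]
      simpa [r] using Setoid.symm' _ hst
    | succ j =>
      have h1 : j.succ - 1 = j.castSucc := by
        rw [sub_eq_iff_eq_add, Fin.coeSucc_eq_succ]
      have h2 : c' j.succ = c j := Fin.cons_succ _ _ _
      rw [h1, h2]
      simpa [r] using hle _ (hc j)
  have hsum : ∑ j, shift a (c' j) (r (j - 1)) (r j) = 0 := by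
    rw [Finset.sum_congr rfl fun j _ => (flatPartition_iff.1 (hflat j)).symm,
      Finset.sum_sub_distrib, sub_eq_zero]
    exact Fintype.sum_equiv (Equiv.subRight 1) _ _ fun j => rfl
  have hcol : ∀ j, c j = i := fun j => by
    simpa [c'] using ha _ c' r hr hsum j.succ 0
  have hpath : ∀ m ≤ p.length, π i s (p.getVert m) := by
    intro m
    induction m with
    | zero => simp
    | succ m ih =>
      intro hm
      have h1 := hc ⟨m, hm⟩
      rw [hcol] at h1
      exact Setoid.trans' _ (ih (by omega)) h1
  simpa using hpath p.length le_rfl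

theorem IsGeneric.exists_flatPartition_eq (ha : IsGeneric a) (hn : 1 ≤ n) {k : Fin ℓ → ℕ}
    (hk : ∑ i, k i + 1 = Fintype.card (Fin n)) {π : Fin ℓ → Setoid (Fin n)}
    (hπ : ∀ i, Nat.card (Quotient (π i)) + k i = Fintype.card (Fin n)) (hsup : ⨆ i, π i = ⊤) :
    ∃ v : sumZero n, ∀ i, flatPartition a i v = π i := by
  obtain ⟨c, f, -, -, hf, hker⟩ := exists_ker_retraction_eq (⟨0, hn⟩ : Fin n) hk hπ hsup
  -- The differences are chosen so that `v` and `f v` have equal translated coordinates in the copy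
  -- `c v`.
  obtain ⟨x, hx⟩ := exists_sub_parent_eq hf
    fun v => height a (c v) (f v) - height a (c v) v
  have hret : ∀ i s, x (retraction c f i s) + height a i (retraction c f i s) =
      x s + height a i s := by
    intro i s
    by_cases h : ∃ hs : s ≠ ⟨0, hn⟩, c ⟨s, hs⟩ = i
    · obtain ⟨hs, rfl⟩ := h
      rw [retraction_of_eq (v := ⟨s, hs⟩) rfl]
      linarith [hx ⟨s, hs⟩]
    · push Not at h
      rw [retraction_of_ne h]
  have hle : ∀ i, π i ≤ flatPartition a i (center hn x) := by
    intro i s t hst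
    rw [← hker, Setoid.ker_def] at hst
    rw [flatPartition_center, ← hret, hst, hret]
  exact ⟨center hn x, fun i => le_antisymm (ha.flatPartition_le hsup hle i) (hle i)⟩

end Bijection
end MultiBraid

theorem mainTheorem5 (ℓ n : ℕ) (hℓ : 1 ≤ ℓ) (hn : 1 ≤ n)
    (a : Matrix (Fin ℓ) (Fin (n - 1)) ℝ) (ha : MultiBraid.IsGeneric a)
    (k : Fin ℓ → ℕ) (hk : ∑ i, k i = n - 1) :
    (({v : MultiBraid.sumZero n | MultiBraid.IsVertex (MultiBraid.multiBraid a) v ∧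
        ∀ i, ∃ F, MultiBraid.IsSmallestFlatContaining (MultiBraid.braidCopy a i) v F ∧
          Module.finrank ℝ F.direction = n - k i - 1}.ncard : ℕ) : ℚ) =
      (n : ℚ) ^ (ℓ - 1) * (Nat.multinomial Finset.univ k : ℚ) *
        ∏ i, ((n : ℚ) - (k i : ℚ)) ^ ((k i : ℤ) - 1) := by
  have hki : ∀ i, k i ≤ n - 1 := fun i =>
    hk ▸ Finset.single_le_sum (fun _ _ => Nat.zero_le _) (Finset.mem_univ i)
  have hk' : ∑ i, k i + 1 = Fintype.card (Fin n) := by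
    rw [Fintype.card_fin]
    omega
  have hset : {v : MultiBraid.sumZero n | MultiBraid.IsVertex (MultiBraid.multiBraid a) v ∧
      ∀ i, ∃ F, MultiBraid.IsSmallestFlatContaining (MultiBraid.braidCopy a i) v F ∧
        Module.finrank ℝ F.direction = n - k i - 1} =
      {v | (∀ i, Nat.card (Quotient (MultiBraid.flatPartition a i v)) + k i =
        Fintype.card (Fin n)) ∧ ⨆ i, MultiBraid.flatPartition a i v = ⊤} := by
    ext v
    simp only [Set.mem_ofPred_eq, MultiBraid.exists_smallestFlat_finrank_iff hn (hki _)]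
    exact ⟨fun h => ⟨h.2, MultiBraid.iSup_flatPartition_eq_top_of_isVertex hn h.1⟩,
      fun h => ⟨MultiBraid.isVertex_of_iSup_flatPartition_eq_top hn h.2, h.1⟩⟩
  rw [hset, ← Nat.card_coe_set_eq]
  let Φ : {v | (∀ i, Nat.card (Quotient (MultiBraid.flatPartition a i v)) + k i =
      Fintype.card (Fin n)) ∧ ⨆ i, MultiBraid.flatPartition a i v = ⊤} →
      {π : Fin ℓ → Setoid (Fin n) //
        (∀ i, Nat.card (Quotient (π i)) + k i = Fintype.card (Fin n)) ∧ ⨆ i, π i = ⊤} :=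
    fun v => ⟨fun i => MultiBraid.flatPartition a i v, v.2⟩
  have hΦ : Function.Bijective Φ := by
    constructor
    · rintro ⟨v, hv⟩ ⟨w, hw⟩ h
      exact Subtype.ext (MultiBraid.eq_of_flatPartition_le hv.2
        fun i => (congrFun (congrArg Subtype.val h) i).le)
    · rintro ⟨π, hπ, hsup⟩
      obtain ⟨v, hv⟩ := ha.exists_flatPartition_eq hn hk' hπ hsup
      obtain rfl : (fun i => MultiBraid.flatPartition a i v) = π := funext hv
      exact ⟨⟨v, hπ, hsup⟩, rfl⟩
  have : Nonempty (Fin n) := ⟨⟨0, hn⟩⟩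
  have hn0 : (n : ℚ) ≠ 0 := by positivity
  rw [Nat.card_congr (Equiv.ofBijective Φ hΦ), MultiBraid.card_hypertrees k hk', Fintype.card_fin,
    Finset.prod_mul_distrib, Finset.prod_const, Finset.card_univ, Fintype.card_fin]
  -- The product over colors contributes `n ^ ℓ`, and the factor `n⁻¹` of the determinant lowers the
  -- exponent to `ℓ - 1`.
  obtain ⟨m, rfl⟩ := Nat.exists_eq_add_of_le' hℓ
  rw [Nat.add_sub_cancel, pow_succ]
  field_simp
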